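/- All graphs are finite and simple. A graph is unicyclic if it is connected and contains exactly one cycle $C$. A set $S\subseteq V(G)$ is a resolving set of a connected graph $G$ if for any two distinct vertices $u,v$ there is $x\in S$ with $d(u,x)\neq d(v,x)$; a metric basis is a resolving set of smallest possible cardinality, this cardinality is the metric dimension $\dim(G)$, and a basis forced vertex is a vertex that belongs to every metric basis of $G$. For a unicyclic graph $G$ with cycle $C$, a vertex $w$ is branching if $w\in V(C)$ and $\deg(w)\geq 4$, or $w\notin V(C)$ and $\deg(w)\geq 3$. A vertex $v\in V(C)$ is branch-active if the component of $G-E(C)$ containing $v$ contains a branching vertex, and $b(G)$ is the number of branch-active vertices on $C$. Let $G$ be a unicyclic graph with girth $g\geq 4$. Then $G$ contains exactly two basis forced vertices if and only if $b(G)=0$, $\dim(G)=2$, and $G$ has a unique metric basis. The same equivalence holds with "at least two" in place of "exactly two". -/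

import Mathlib

namespace SimpleGraph

/-- A unicyclic graph: a connected graph with exactly one cycle. A cycle is identified with its set
of edges, so that a closed walk and its rotations and reversal count as the same cycle. -/
def IsUnicyclic {V : Type*} (G : SimpleGraph V) : Prop :=
  G.Connected ∧ ∃! C : Set (Sym2 V), ∃ (u : V) (p : G.Walk u u), p.IsCycle ∧ C = {e | e ∈ p.edges}

/-- The set of vertices lying on a cycle; this is `V(C)` when `G` is unicyclic with cycle `C`. -/
def cycleVertices {V : Type*} (G : SimpleGraph V) : Set V :=
  {v | ∃ (u : V) (p : G.Walk u u), p.IsCycle ∧ v ∈ p.support}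

/-- The set of edges lying on a cycle; this is `E(C)` when `G` is unicyclic with cycle `C`. -/
def cycleEdges {V : Type*} (G : SimpleGraph V) : Set (Sym2 V) :=
  {e | ∃ (u : V) (p : G.Walk u u), p.IsCycle ∧ e ∈ p.edges}

/-- The vertex set of `T_v`, the component of `G - E(C)` that contains `v`. -/
def cycleComponent {V : Type*} (G : SimpleGraph V) (v : V) : Set V :=
  {w | (G.deleteEdges G.cycleEdges).Reachable v w}

/-- A branching vertex: a cycle vertex of degree at least 4, or a vertex outside the cycle of degree
at least 3 (degrees are taken in `G`). -/
def IsBranching {V : Type*} [Fintype V] (G : SimpleGraph V) [DecidableRel G.Adj] (v : V) : Prop :=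
  (v ∈ G.cycleVertices ∧ 4 ≤ G.degree v) ∨ (v ∉ G.cycleVertices ∧ 3 ≤ G.degree v)

/-- A cycle vertex `v` is branch-active if `T_v` contains a branching vertex. -/
def IsBranchActive {V : Type*} [Fintype V] (G : SimpleGraph V) [DecidableRel G.Adj] (v : V) :
    Prop :=
  v ∈ G.cycleVertices ∧ ∃ w ∈ G.cycleComponent v, G.IsBranching w

/-- `b(G)`, the number of branch-active vertices. -/
noncomputable def branchActiveCount {V : Type*} [Fintype V] (G : SimpleGraph V)
    [DecidableRel G.Adj] : ℕ :=
  {v | G.IsBranchActive v}.ncard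

/-- The vertex `x` resolves `u` and `v`. -/
def Resolves {V : Type*} (G : SimpleGraph V) (x u v : V) : Prop :=
  G.dist u x ≠ G.dist v x

/-- A resolving set: any two distinct vertices are resolved by a member of `S`. -/
def IsResolvingSet {V : Type*} (G : SimpleGraph V) (S : Finset V) : Prop :=
  ∀ u v : V, u ≠ v → ∃ x ∈ S, G.Resolves x u v

/-- `dim(G)`, the smallest cardinality of a resolving set. In a finite connected graph the set of
all vertices is resolving, so the infimum is attained. -/
noncomputable def metricDim {V : Type*} (G : SimpleGraph V) : ℕ :=
  sInf {n | ∃ S : Finset V, G.IsResolvingSet S ∧ S.card = n}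

/-- A metric basis: a resolving set of the smallest possible cardinality. -/
def IsMetricBasis {V : Type*} (G : SimpleGraph V) (S : Finset V) : Prop :=
  G.IsResolvingSet S ∧ S.card = G.metricDim

/-- A basis forced vertex: a vertex that belongs to every metric basis. -/
def IsBasisForced {V : Type*} (G : SimpleGraph V) (v : V) : Prop :=
  ∀ S : Finset V, G.IsMetricBasis S → v ∈ S

end SimpleGraph

/-! Number the cycle and let every vertex have a root, the cycle vertex whose tree contains it. A
resolving set must meet one of any two sibling branches (be branch resolving) and must contain two
members with distinct, non-antipodal roots. Conversely, a branch resolving set is resolving as soon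
as two such members and a third one have roots at pairwise distances summing to `g`
(`IsBranchResolving.isResolvingSet`).

Let `x` be forced and `S` a basis with another member. If `S \ {x}` were not branch resolving, `x`
could be exchanged for another vertex (`exists_insert_of_not_isBranchResolving`). So `S \ {x}` is
branch resolving. If it contains `p`, `q` with distinct, non-antipodal roots, any cycle vertex
completing their roots to a geodesic triple can replace `x`. It must therefore be unique, which
forces `g` odd, adjacent roots, and `x` opposite to them.

With two forced vertices `x`, `y` and `g ≥ 4`, this leaves `{x, y}` as the only such pair in `S`,
and then no room for a third member. Hence `{x, y}` is the only basis. Both singletons are branch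
resolving and the roots differ, so there is no branching vertex. The converse is immediate: the
forced vertices are the two members of the unique basis. -/

namespace SimpleGraph

/-! ### Arithmetic of distances on a cycle -/

/-- The distance between `i` and `j` along a cycle whose vertices are numbered `0, …, g - 1`. -/
def cycDist (g i j : ℕ) : ℕ := min (i - j + (j - i)) (g - (i - j + (j - i)))

theorem cycDist_comm (g i j : ℕ) : cycDist g i j = cycDist g j i := by
  simp only [cycDist, Nat.add_comm]

theorem cycDist_self (g i : ℕ) : cycDist g i i = 0 := by simp [cycDist]

theorem cycDist_spec {g i j : ℕ} (hij : i ≤ j) (hj : j < g) :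
    2 * (j - i) ≤ g ∧ cycDist g i j = j - i ∨ g < 2 * (j - i) ∧ cycDist g i j + (j - i) = g := by
  simp only [cycDist]; omega

theorem cycDist_triangle {g i j k : ℕ} (hi : i < g) (hj : j < g) (hk : k < g) :
    cycDist g i k ≤ cycDist g i j + cycDist g j k := by
  wlog hik : i ≤ k generalizing i k
  · have := this hk hi (by omega)
    rw [cycDist_comm g i k, cycDist_comm g i j, cycDist_comm g j k]; omega
  have h := cycDist_spec hik hk
  rcases le_total i j with h1 | h1 <;> rcases le_total j k with h2 | h2
  · have := cycDist_spec h1 hj; have := cycDist_spec h2 hk; omega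
  · have := cycDist_spec h1 hj; have := cycDist_spec h2 hj
    rw [cycDist_comm g j k]; omega
  · have := cycDist_spec h1 hi; have := cycDist_spec h2 hk
    rw [cycDist_comm g i j]; omega
  · omega

/-- Equidistant vertices are mirror images in `p`, that is `a + b ≡ 2p` modulo `g`; the cases are
the possible representatives. -/
theorem add_eq_of_cycDist_eq {g a b p : ℕ} (ha : a < g) (hb : b < g) (hp : p < g) (hab : a ≠ b)
    (h : cycDist g a p = cycDist g b p) :
    a + b = 2 * p ∨ a + b + g = 2 * p ∨ a + b = 2 * p + g := by
  rcases le_total a p with h1 | h1 <;> rcases le_total b p with h2 | h2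
  · have := cycDist_spec h1 hp; have := cycDist_spec h2 hp; omega
  · have := cycDist_spec h1 hp; have := cycDist_spec h2 hb
    rw [cycDist_comm g b p] at h; omega
  · have := cycDist_spec h1 ha; have := cycDist_spec h2 hp
    rw [cycDist_comm g a p] at h; omega
  · have := cycDist_spec h1 ha; have := cycDist_spec h2 hb
    rw [cycDist_comm g a p, cycDist_comm g b p] at h; omega

/-- Two distinct vertices of a cycle that are not antipodal resolve it. -/
theorem eq_of_cycDist_eq {g a b p q : ℕ} (ha : a < g) (hb : b < g) (hp : p < g) (hq : q < g)
    (hpq : p ≠ q) (h : 2 * cycDist g p q ≠ g) (h1 : cycDist g a p = cycDist g b p)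
    (h2 : cycDist g a q = cycDist g b q) : a = b := by
  by_contra hab
  -- The two reflections give `2p ≡ 2q` modulo `g`, so `p` and `q` would be equal or antipodal.
  have h3 := add_eq_of_cycDist_eq ha hb hp hab h1
  have h4 := add_eq_of_cycDist_eq ha hb hq hab h2
  rcases le_total p q with h5 | h5
  · have := cycDist_spec h5 hq; omega
  · have := cycDist_spec h5 hp; rw [cycDist_comm] at h; omega

/-- Three vertices of a cycle whose pairwise distances sum up to its length. -/
def IsGeodesicTriple (g i j k : ℕ) : Prop :=
  cycDist g i j + cycDist g j k + cycDist g i k = g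

theorem IsGeodesicTriple.swap_left {g i j k : ℕ} (h : IsGeodesicTriple g i j k) :
    IsGeodesicTriple g j i k := by
  have := cycDist_comm g i j
  unfold IsGeodesicTriple at *; omega

theorem IsGeodesicTriple.swap_right {g i j k : ℕ} (h : IsGeodesicTriple g i j k) :
    IsGeodesicTriple g i k j := by
  have := cycDist_comm g j k
  unfold IsGeodesicTriple at *; omega

/-- A vertex of a cycle lies between two members of a geodesic triple. -/
theorem IsGeodesicTriple.between {g i j k a : ℕ} (h : IsGeodesicTriple g i j k) (hi : i < g)
    (hj : j < g) (hk : k < g) (ha : a < g) :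
    cycDist g a i + cycDist g a j = cycDist g i j ∨ cycDist g a j + cycDist g a k = cycDist g j k ∨
      cycDist g a i + cycDist g a k = cycDist g i k := by
  wlog hij : i ≤ j generalizing i j k
  · have := this h.swap_left hj hi hk (by omega)
    rw [cycDist_comm g j i] at this; omega
  wlog hjk : j ≤ k generalizing i j k
  · rcases le_total i k with hik | hik
    · have := this h.swap_right hi hk hj hik (by omega)
      rw [cycDist_comm g k j] at this; omega
    · have := this h.swap_right.swap_left hk hi hj hik (by omega)
      rw [cycDist_comm g k i, cycDist_comm g k j] at this; omega
  -- Each distance is at most the length of its arc and the three arcs add up to `g`, so all arcs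
  -- are geodesics; `a` lies on one of them.
  unfold IsGeodesicTriple at h
  have h1 := cycDist_spec hij hj
  have h2 := cycDist_spec hjk hk
  have h3 := cycDist_spec (hij.trans hjk) hk
  rcases le_total a i with h4 | h4
  · have := cycDist_spec h4 hi; have := cycDist_spec (h4.trans (hij.trans hjk)) hk; omega
  rcases le_total a j with h5 | h5
  · have := cycDist_spec h4 ha; have := cycDist_spec h5 hj; rw [cycDist_comm g a i]; omega
  rcases le_total a k with h6 | h6
  · have := cycDist_spec h5 ha; have := cycDist_spec h6 hk; rw [cycDist_comm g a j]; omega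
  · have := cycDist_spec h4 ha; have := cycDist_spec h6 ha
    rw [cycDist_comm g a i, cycDist_comm g a k]; omega

theorem cycDist_pos {g i j : ℕ} (hi : i < g) (hj : j < g) (h : i ≠ j) : 0 < cycDist g i j := by
  simp only [cycDist]; omega

/-- The completing vertices fill the arc between the antipodes of `p` and `q`; `m₁` and `m₂` are its
ends. For odd `g` rounding shortens this arc by one, the only way for the ends to coincide. -/
theorem exists_isGeodesicTriple {g p q : ℕ} (hg : 4 ≤ g) (hp : p < g) (hq : q < g) (hpq : p ≠ q)
    (h : 2 * cycDist g p q ≠ g) : ∃ m₁ m₂, m₁ < g ∧ m₂ < g ∧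
      (m₁ = m₂ → g % 2 = 1 ∧ cycDist g p q = 1) ∧
      IsGeodesicTriple g p q m₁ ∧ IsGeodesicTriple g p q m₂ := by
  wlog hlt : p < q generalizing p q
  · obtain ⟨m, n, h1, h2, h3, h4, h5⟩ :=
      this hq hp hpq.symm (by rwa [cycDist_comm]) (by omega)
    exact ⟨m, n, h1, h2, by rwa [cycDist_comm], h4.swap_left, h5.swap_left⟩
  have key : ∀ m < g, (q ≤ m ∧ 2 * (m - q) ≤ g ∧ g ≤ 2 * (m - p) ∧ 2 * (q - p) ≤ g) ∨
      (m ≤ p ∧ 2 * (p - m) ≤ g ∧ g ≤ 2 * (q - m) ∧ 2 * (q - p) ≤ g) ∨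
      (p ≤ m ∧ m ≤ q ∧ 2 * (m - p) ≤ g ∧ 2 * (q - m) ≤ g ∧ g ≤ 2 * (q - p)) →
      IsGeodesicTriple g p q m := by
    intro m hm hc
    unfold IsGeodesicTriple
    have h1 := cycDist_spec hlt.le hq
    rcases hc with hc | hc | hc
    · have := cycDist_spec hc.1 hm; have := cycDist_spec (hlt.le.trans hc.1) hm; omega
    · have := cycDist_spec hc.1 hp; have := cycDist_spec (hc.1.trans hlt.le) hq
      rw [cycDist_comm g q m, cycDist_comm g p m]; omega
    · have := cycDist_spec hc.1 hm; have := cycDist_spec hc.2.1 hq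
      rw [cycDist_comm g q m]; omega
  have hs := cycDist_spec hlt.le hq
  rcases Nat.lt_or_ge (2 * (q - p)) g with hc | hc
  · obtain ⟨m₁, h1⟩ : ∃ m, (p + (g + 1) / 2 < g ∧ m = p + (g + 1) / 2) ∨
        (g ≤ p + (g + 1) / 2 ∧ m + g = p + (g + 1) / 2) := by
      rcases Nat.lt_or_ge (p + (g + 1) / 2) g with h | h
      · exact ⟨_, .inl ⟨h, rfl⟩⟩
      · exact ⟨p + (g + 1) / 2 - g, .inr ⟨h, by omega⟩⟩
    obtain ⟨m₂, h2⟩ : ∃ m, (q + g / 2 < g ∧ m = q + g / 2) ∨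
        (g ≤ q + g / 2 ∧ m + g = q + g / 2) := by
      rcases Nat.lt_or_ge (q + g / 2) g with h | h
      · exact ⟨_, .inl ⟨h, rfl⟩⟩
      · exact ⟨q + g / 2 - g, .inr ⟨h, by omega⟩⟩
    exact ⟨m₁, m₂, by omega, by omega, by omega, key _ (by omega) (by omega),
      key _ (by omega) (by omega)⟩
  · exact ⟨q - g / 2, p + g / 2, by omega, by omega, by omega, key _ (by omega) (by omega),
      key _ (by omega) (by omega)⟩

/-- The arithmetic behind the fact that a geodesic triple of active cycle vertices resolves all
pairs of vertices that hang at distinct cycle vertices `a` and `b`, at heights `h` and `h'`. -/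
theorem IsGeodesicTriple.eq_of_forall {g i j k a b h h' : ℕ} (hT : IsGeodesicTriple g i j k)
    (hi : i < g) (hj : j < g) (hk : k < g) (ha : a < g) (hb : b < g) (hij : i ≠ j)
    (hne : 2 * cycDist g i j ≠ g)
    (H : ∀ m, m = i ∨ m = j ∨ m = k →
      (m ≠ a → m ≠ b → h + cycDist g a m = h' + cycDist g b m) ∧
      (m = a → h' + cycDist g b m ≤ h) ∧ (m = b → h + cycDist g a m ≤ h')) : a = b := by
  by_contra hab
  wlog hh : h ≤ h' generalizing a b h h'
  · exact this hb ha (fun m hm => ⟨fun h1 h2 => ((H m hm).1 h2 h1).symm, (H m hm).2.2,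
      (H m hm).2.1⟩) (Ne.symm hab) (by omega)
  have hna : ∀ m, m = i ∨ m = j ∨ m = k → m ≠ a := by
    rintro m hm rfl
    have := (H m hm).2.1 rfl
    have := cycDist_pos hb ha (Ne.symm hab)
    omega
  -- As `a` lies on a geodesic from `m` to `n`, its distances to them sum to at most those of `b`;
  -- adding the two equations gives `h ≥ h'`. A member at `b` would give `h > h'`.
  have key : ∀ m n, (m = i ∨ m = j ∨ m = k) → (n = i ∨ n = j ∨ n = k) → m ≠ n → m < g → n < g →
      cycDist g a m + cycDist g a n = cycDist g m n → h = h' := by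
    intro m n hm hn hmn hmg hng hbet
    by_cases h1 : m = b
    · have := (H n hn).1 (hna n hn) (by rintro rfl; exact hmn h1)
      have := cycDist_pos ha hmg (Ne.symm (hna m hm))
      subst h1; omega
    by_cases h2 : n = b
    · have := (H m hm).1 (hna m hm) h1
      have := cycDist_pos ha hng (Ne.symm (hna n hn))
      rw [cycDist_comm g m n] at hbet
      subst h2; omega
    have := (H m hm).1 (hna m hm) h1
    have := (H n hn).1 (hna n hn) h2
    have := cycDist_triangle hmg hb hng
    rw [cycDist_comm g m b] at this
    omega
  have hik : i ≠ k := by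
    rintro rfl
    have := cycDist_comm g i j
    have := cycDist_self g i
    unfold IsGeodesicTriple at hT; omega
  have hjk : j ≠ k := by
    rintro rfl
    have := cycDist_self g j
    unfold IsGeodesicTriple at hT; omega
  have heq : h = h' := by
    rcases hT.between hi hj hk ha with hc | hc | hc
    · exact key i j (by simp) (by simp) hij hi hj hc
    · exact key j k (by simp) (by simp) hjk hj hk hc
    · exact key i k (by simp) (by simp) hik hi hk hc
  have hnb : ∀ m, m = i ∨ m = j ∨ m = k → m ≠ b := by
    rintro m hm rfl
    have := (H m hm).2.2 rfl
    have := cycDist_pos ha hb hab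
    omega
  have e1 := (H i (by simp)).1 (hna i (by simp)) (hnb i (by simp))
  have e2 := (H j (by simp)).1 (hna j (by simp)) (hnb j (by simp))
  exact hab (eq_of_cycDist_eq ha hb hi hj hij hne (by omega) (by omega))

/-! ### Distances in a cycle with hanging trees -/

/-- A connected graph made of a chordless cycle `c 0, …, c (g - 1)` and trees hanging from it.
Every vertex has a height, its distance to the cycle; a vertex outside the cycle has a parent, its
only neighbor that is not higher; `root v` is the number of the cycle vertex that `v` hangs from. -/
structure CycleFrame {V : Type*} (G : SimpleGraph V) (g : ℕ) where
  c : ℕ → V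
  height : V → ℕ
  parent : V → V
  root : V → ℕ
  connected : G.Connected
  root_lt : ∀ v, root v < g
  root_c : ∀ i < g, root (c i) = i
  height_c : ∀ i < g, height (c i) = 0
  c_root : ∀ v, height v = 0 → c (root v) = v
  adj_c : ∀ i < g, ∀ j < g, (G.Adj (c i) (c j) ↔ cycDist g i j = 1)
  adj_parent : ∀ v, height v ≠ 0 → G.Adj v (parent v)
  height_parent : ∀ v, height v ≠ 0 → height v = height (parent v) + 1
  eq_parent : ∀ v w, height v ≠ 0 → G.Adj v w → height w ≤ height v → w = parent v
  root_parent : ∀ v, height v ≠ 0 → root (parent v) = root v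

namespace CycleFrame

variable {V : Type*} {G : SimpleGraph V} {g : ℕ} (F : G.CycleFrame g)

theorem adj_cases {u v : V} (h : G.Adj u v) :
    (F.height u = 0 ∧ F.height v = 0 ∧ cycDist g (F.root u) (F.root v) = 1) ∨
      (F.height u ≠ 0 ∧ F.parent u = v) ∨ (F.height v ≠ 0 ∧ F.parent v = u) := by
  by_cases hu : F.height u = 0
  · by_cases hv : F.height v = 0
    · refine .inl ⟨hu, hv, ?_⟩
      rw [← F.adj_c _ (F.root_lt u) _ (F.root_lt v), F.c_root u hu, F.c_root v hv]
      exact h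
    · exact .inr (.inr ⟨hv, (F.eq_parent v u hv h.symm (by omega)).symm⟩)
  · rcases le_total (F.height v) (F.height u) with hle | hle
    · exact .inr (.inl ⟨hu, (F.eq_parent u v hu h hle).symm⟩)
    · exact .inr (.inr ⟨by omega, (F.eq_parent v u (by omega) h.symm hle).symm⟩)

theorem height_le_of_adj {u v : V} (h : G.Adj u v) : F.height u ≤ F.height v + 1 := by
  rcases F.adj_cases h with h | ⟨h', rfl⟩ | ⟨h', rfl⟩
  · omega
  · have := F.height_parent u h'; omega
  · have := F.height_parent v h'; omega

theorem height_le (u v : V) : F.height u ≤ G.dist u v + F.height v := by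
  obtain ⟨p, hp⟩ := F.connected.exists_walk_length_eq_dist u v
  rw [← hp]
  clear hp
  induction p with
  | nil => simp
  | cons h p ih => have := F.height_le_of_adj h; simp only [Walk.length_cons]; omega

theorem dist_parent {v : V} (h : F.height v ≠ 0) : G.dist v (F.parent v) = 1 :=
  dist_eq_one_iff_adj.2 (F.adj_parent v h)

/-- `t` is a descendant of `v`. -/
def Desc (v t : V) : Prop := F.height t = G.dist t v + F.height v

variable {F}

theorem desc_refl (v : V) : F.Desc v v := by simp [Desc]

theorem Desc.trans {u v t : V} (h : F.Desc u v) (h' : F.Desc v t) : F.Desc u t := by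
  have := F.height_le t u
  have := F.connected.dist_triangle (u := t) (v := v) (w := u)
  unfold Desc at *; omega

theorem desc_parent {v : V} (h : F.height v ≠ 0) : F.Desc (F.parent v) v := by
  unfold Desc
  rw [F.dist_parent h]
  have := F.height_parent v h
  omega

theorem Desc.height_ne_zero {v t : V} (h : F.Desc v t) (hv : F.height v ≠ 0) :
    F.height t ≠ 0 := by
  unfold Desc at h; omega

/-- Along a shortest walk from `t` to `v` the height drops at each step, and the only lower neighbor
is the parent. -/
theorem Desc.parent {v t : V} (h : F.Desc v t) (hne : t ≠ v) :
    F.height t ≠ 0 ∧ F.Desc v (F.parent t) := by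
  have hpos := F.connected.pos_dist_of_ne hne
  obtain ⟨p, hp⟩ := F.connected.exists_walk_length_eq_dist t v
  cases p with
  | nil => exact absurd rfl hne
  | @cons _ a _ hadj p =>
    have h1 := dist_le p
    have h2 := F.height_le a v
    have h3 := F.height_le_of_adj hadj
    have hl := F.height_le t a
    simp only [Walk.length_cons] at hp
    unfold Desc at *
    have h0 : F.height t ≠ 0 := by omega
    have h4 := F.eq_parent t a h0 hadj (by omega)
    subst h4
    refine ⟨h0, by omega⟩

theorem Desc.root_eq {v t : V} (h : F.Desc v t) : F.root t = F.root v := by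
  induction hn : G.dist t v generalizing t with
  | zero => rw [(F.connected.dist_eq_zero_iff).1 hn]
  | succ n ih =>
    have hne : t ≠ v := by rintro rfl; simp at hn
    obtain ⟨h0, hp⟩ := h.parent hne
    rw [← F.root_parent t h0]
    apply ih hp
    have := F.height_parent t h0
    unfold Desc at *; omega

/-- A path leaves the set of descendants of `v` through `v` and its parent. -/
theorem Desc.dist_eq {v t z : V} (hv : F.height v ≠ 0) (ht : F.Desc v t) (hz : ¬ F.Desc v z) :
    G.dist t z = G.dist t v + 1 + G.dist (F.parent v) z := by
  apply le_antisymm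
  · have h1 := F.connected.dist_triangle (u := t) (v := v) (w := z)
    have h2 := F.connected.dist_triangle (u := v) (v := F.parent v) (w := z)
    rw [F.dist_parent hv] at h2
    omega
  · obtain ⟨p, hp⟩ := F.connected.exists_walk_length_eq_dist t z
    rw [← hp]
    clear hp
    induction p with
    | nil => exact absurd ht hz
    | @cons t a z hadj p ih =>
      simp only [Walk.length_cons]
      by_cases ha : F.Desc v a
      · have h1 := ih ha hz
        have h2 := F.connected.dist_triangle (u := t) (v := a) (w := v)
        rw [dist_eq_one_iff_adj.2 hadj] at h2
        omega
      -- The only edge leaving the set of descendants joins `v` to its parent.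
      · have htv : t = v ∧ F.parent t = a := by
          rcases F.adj_cases hadj with h | ⟨h, rfl⟩ | ⟨h, rfl⟩
          · exact absurd h.1 (ht.height_ne_zero hv)
          · refine ⟨?_, rfl⟩
            by_contra hne
            exact ha (ht.parent hne).2
          · exact absurd (ht.trans (desc_parent h)) ha
        obtain ⟨rfl, rfl⟩ := htv
        have := dist_le p
        simp; omega

variable (F)

theorem dist_of_root_ne_aux {u t : V} (h : F.root u ≠ F.root t) :
    G.dist u t = F.height u + G.dist (F.c (F.root u)) t := by
  induction hn : F.height u generalizing u with
  | zero => simp [F.c_root u hn]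
  | succ n ih =>
    have h0 : F.height u ≠ 0 := by omega
    have h1 : ¬ F.Desc u t := fun hd => h hd.root_eq.symm
    have h2 := F.height_parent u h0
    have h3 := ih (u := F.parent u) (by rwa [F.root_parent u h0]) (by omega)
    rw [F.root_parent u h0] at h3
    rw [(desc_refl u).dist_eq h0 h1, h3]
    simp; omega

theorem dist_c_root (u : V) : G.dist u (F.c (F.root u)) = F.height u := by
  induction hn : F.height u generalizing u with
  | zero => simp [F.c_root u hn]
  | succ n ih =>
    have h0 : F.height u ≠ 0 := by omega
    have h2 := F.height_parent u h0
    have h3 := ih (F.parent u) (by omega)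
    rw [F.root_parent u h0] at h3
    have h4 := F.connected.dist_triangle (u := u) (v := F.parent u) (w := F.c (F.root u))
    rw [F.dist_parent h0] at h4
    have h5 := F.height_le u (F.c (F.root u))
    rw [F.height_c _ (F.root_lt u)] at h5
    omega

/-- Taking roots retracts the graph onto the cycle and stretches no edge. -/
theorem cycDist_root_le (u t : V) : cycDist g (F.root u) (F.root t) ≤ G.dist u t := by
  obtain ⟨p, hp⟩ := F.connected.exists_walk_length_eq_dist u t
  rw [← hp]
  clear hp
  induction p with
  | nil => simp [cycDist_self]
  | @cons u a t h p ih =>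
    have h1 := cycDist_triangle (F.root_lt u) (F.root_lt a) (F.root_lt t)
    simp only [Walk.length_cons]
    rcases F.adj_cases h with h | ⟨h', rfl⟩ | ⟨h', rfl⟩
    · omega
    · rw [F.root_parent u h'] at ih; omega
    · rw [F.root_parent a h']; omega

theorem dist_c_add_le (i k : ℕ) (h : i + k < g) : G.dist (F.c i) (F.c (i + k)) ≤ k := by
  induction k with
  | zero => simp
  | succ k ih =>
    have h1 := ih (by omega)
    have h2 := F.connected.dist_triangle (u := F.c i) (v := F.c (i + k)) (w := F.c (i + (k + 1)))
    have h3 : cycDist g (i + k) (i + (k + 1)) = 1 := by simp only [cycDist]; omega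
    rw [dist_eq_one_iff_adj.2 ((F.adj_c _ (by omega) _ h).2 h3)] at h2
    omega

theorem dist_c_le {i j : ℕ} (hi : i < g) (hj : j < g) :
    G.dist (F.c i) (F.c j) ≤ cycDist g i j := by
  wlog hij : i ≤ j generalizing i j
  · rw [dist_comm, cycDist_comm]; exact this hj hi (by omega)
  have h1 := F.dist_c_add_le i (j - i) (by omega)
  have h2 := F.dist_c_add_le 0 i (by omega)
  have h3 := F.dist_c_add_le j (g - 1 - j) (by omega)
  rw [show i + (j - i) = j by omega] at h1
  rw [show j + (g - 1 - j) = g - 1 by omega] at h3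
  rw [Nat.zero_add] at h2
  have h5 := F.connected.dist_triangle (u := F.c i) (v := F.c 0) (w := F.c j)
  have h6 := F.connected.dist_triangle (u := F.c 0) (v := F.c (g - 1)) (w := F.c j)
  have h4 : G.dist (F.c 0) (F.c (g - 1)) ≤ 1 := by
    by_cases hg : g = 1
    · simp [hg]
    · rw [dist_eq_one_iff_adj.2 ((F.adj_c 0 (by omega) (g - 1) (by omega)).2
        (by simp only [cycDist]; omega))]
  rw [dist_comm] at h2 h3
  rcases cycDist_spec hij hj with h | h
  · omega
  · omega

theorem dist_of_root_ne {u t : V} (h : F.root u ≠ F.root t) :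
    G.dist u t = F.height u + cycDist g (F.root u) (F.root t) + F.height t := by
  have hu := F.root_lt u
  have ht := F.root_lt t
  have h2 := F.dist_of_root_ne_aux (u := t) (t := F.c (F.root u))
    (by rw [F.root_c _ hu]; exact h.symm)
  have h3 := F.dist_c_le hu ht
  have h4 := F.cycDist_root_le (F.c (F.root u)) (F.c (F.root t))
  rw [F.root_c _ hu, F.root_c _ ht] at h4
  rw [F.dist_of_root_ne_aux h, dist_comm, h2, dist_comm]
  omega

theorem dist_le_height_add (u t : V) (h : F.root u = F.root t) :
    G.dist u t ≤ F.height u + F.height t := by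
  have h1 := F.connected.dist_triangle (u := u) (v := F.c (F.root u)) (w := t)
  rw [F.dist_c_root u, h, dist_comm (u := F.c (F.root t)), F.dist_c_root t] at h1
  exact h1

variable {F}

theorem not_desc_of_siblings {v₁ v₂ t : V} (hne : v₁ ≠ v₂) (h₁ : F.height v₁ ≠ 0)
    (h₂ : F.height v₂ ≠ 0) (hp : F.parent v₁ = F.parent v₂) (ht : F.Desc v₁ t) :
    ¬ F.Desc v₂ t := by
  intro ht'
  have e1 := F.height_parent v₁ h₁
  have e2 := F.height_parent v₂ h₂
  have h12 : ¬ F.Desc v₁ v₂ := by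
    intro hd
    unfold Desc at hd
    rw [← hp] at e2
    exact hne ((F.connected.dist_eq_zero_iff).1 (by omega)).symm
  have := ht.dist_eq h₁ h12
  unfold Desc at ht ht'
  rw [hp] at e1
  omega

/-- Two vertices of the same height that hang from the same cycle vertex descend from siblings. -/
theorem exists_siblings {u t : V} (hne : u ≠ t) (hh : F.height u = F.height t)
    (hr : F.root u = F.root t) : ∃ v₁ v₂, v₁ ≠ v₂ ∧ F.height v₁ ≠ 0 ∧ F.height v₂ ≠ 0 ∧
      F.parent v₁ = F.parent v₂ ∧ F.Desc v₁ u ∧ F.Desc v₂ t := by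
  induction hn : F.height u generalizing u t with
  | zero => exact absurd (by rw [← F.c_root u hn, ← F.c_root t (by omega), hr]) hne
  | succ n ih =>
    have hu : F.height u ≠ 0 := by omega
    have ht : F.height t ≠ 0 := by omega
    by_cases hp : F.parent u = F.parent t
    · exact ⟨u, t, hne, hu, ht, hp, desc_refl u, desc_refl t⟩
    · have e1 := F.height_parent u hu
      have e2 := F.height_parent t ht
      obtain ⟨v₁, v₂, h1, h2, h3, h4, h5, h6⟩ := ih hp (by omega)
        (by rw [F.root_parent u hu, F.root_parent t ht, hr]) (by omega)
      exact ⟨v₁, v₂, h1, h2, h3, h4, h5.trans (desc_parent hu), h6.trans (desc_parent ht)⟩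

/-- Otherwise the route from `u` to its ancestor `w` would leave the branch of `v` and end below the
height of `v`. -/
theorem Desc.nested {v w u : V} (h : F.Desc v u) (h' : F.Desc w u) (hle : F.height v ≤ F.height w)
    (hv : F.height v ≠ 0) : F.Desc v w := by
  by_contra hn
  have := h.dist_eq hv hn
  unfold Desc at *
  omega

/-! ### Branch resolving sets and exchange of members -/

variable (F)

/-- Among any two sibling branches outside the cycle at least one contains a member of `R`. -/
def IsBranchResolving (R : Finset V) : Prop :=
  ∀ v₁ v₂, v₁ ≠ v₂ → F.height v₁ ≠ 0 → F.height v₂ ≠ 0 → F.parent v₁ = F.parent v₂ →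
    ∃ s ∈ R, F.Desc v₁ s ∨ F.Desc v₂ s

variable {F}

theorem IsBranchResolving.mono {R S : Finset V} (h : F.IsBranchResolving R) (hRS : R ⊆ S) :
    F.IsBranchResolving S := fun v₁ v₂ hne h₁ h₂ hp => by
  obtain ⟨s, hs, hd⟩ := h v₁ v₂ hne h₁ h₂ hp
  exact ⟨s, hRS hs, hd⟩

variable (F) in
-- A vertex outside both branches is reached through the common parent, so it does not resolve `v₁`
-- and `v₂`.
theorem isBranchResolving {S : Finset V} (hS : G.IsResolvingSet S) : F.IsBranchResolving S := by
  intro v₁ v₂ hne h₁ h₂ hp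
  obtain ⟨s, hs, hr⟩ := hS v₁ v₂ hne
  refine ⟨s, hs, ?_⟩
  by_contra! hn
  refine hr ?_
  rw [(desc_refl v₁).dist_eq h₁ hn.1, (desc_refl v₂).dist_eq h₂ hn.2, hp]
  simp

/-- From `t` one reaches `s` only over the common parent and `v₁`, at least two steps more than from
`u`. -/
theorem resolves_of_desc {v₁ v₂ u t s : V} (hne : v₁ ≠ v₂) (h₁ : F.height v₁ ≠ 0)
    (h₂ : F.height v₂ ≠ 0) (hp : F.parent v₁ = F.parent v₂) (hu : F.Desc v₁ u) (ht : F.Desc v₂ t)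
    (hh : F.height u = F.height t) (hs : F.Desc v₁ s) : G.Resolves s u t := by
  have e1 := F.height_parent v₁ h₁
  have e2 := F.height_parent v₂ h₂
  have d1 := ht.dist_eq h₂ (not_desc_of_siblings hne h₁ h₂ hp hs)
  have d2 := hs.dist_eq h₁ (not_desc_of_siblings hne.symm h₂ h₁ hp.symm (desc_refl v₂))
  have d3 := F.connected.dist_triangle (u := u) (v := v₁) (w := s)
  have d4 := F.connected.dist_triangle (u := v₁) (v := F.parent v₁) (w := s)
  have d5 := hs.dist_eq h₁ (z := F.parent v₁) (by
    intro hd; unfold Desc at hd; omega)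
  rw [dist_self, dist_comm] at d5
  rw [dist_comm (u := s) (v := v₁)] at d5
  unfold Resolves Desc at *
  rw [hp] at *
  omega

/-- For a common root, a member with another root compares heights, and vertices of equal height lie
in sibling branches. Distinct roots are settled by the geodesic triple. -/
theorem IsBranchResolving.isResolvingSet {S : Finset V} (hS : F.IsBranchResolving S) {p q r : V}
    (hp : p ∈ S) (hq : q ∈ S) (hr : r ∈ S) (hpq : F.root p ≠ F.root q)
    (hne : 2 * cycDist g (F.root p) (F.root q) ≠ g)
    (hT : IsGeodesicTriple g (F.root p) (F.root q) (F.root r)) : G.IsResolvingSet S := by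
  intro u t hut
  by_contra! hn
  replace hn : ∀ s ∈ S, G.dist u s = G.dist t s := fun s hs => not_not.1 (hn s hs)
  by_cases hroot : F.root u = F.root t
  · have hh : F.height u = F.height t := by
      obtain ⟨s, hs, hsu⟩ : ∃ s ∈ S, F.root u ≠ F.root s := by
        by_contra! hall
        exact hpq ((hall p hp).symm.trans (hall q hq))
      have := hn s hs
      rw [F.dist_of_root_ne hsu, F.dist_of_root_ne (hroot ▸ hsu), hroot] at this
      omega
    obtain ⟨v₁, v₂, h1, h2, h3, h4, h5, h6⟩ := exists_siblings hut hh hroot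
    obtain ⟨s, hs, hd | hd⟩ := hS v₁ v₂ h1 h2 h3 h4
    · exact resolves_of_desc h1 h2 h3 h4 h5 h6 hh hd (hn s hs)
    · exact resolves_of_desc h1.symm h3 h2 h4.symm h6 h5 hh.symm hd (hn s hs).symm
  · refine hroot (hT.eq_of_forall (F.root_lt p) (F.root_lt q) (F.root_lt r) (F.root_lt u)
      (F.root_lt t) hpq hne (h := F.height u) (h' := F.height t) ?_)
    intro m hm
    obtain ⟨s, hs, rfl⟩ : ∃ s ∈ S, F.root s = m := by
      rcases hm with rfl | rfl | rfl
      exacts [⟨p, hp, rfl⟩, ⟨q, hq, rfl⟩, ⟨r, hr, rfl⟩]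
    have e := hn s hs
    refine ⟨fun hu ht => ?_, fun hu => ?_, fun ht => ?_⟩
    · rw [F.dist_of_root_ne hu.symm, F.dist_of_root_ne ht.symm] at e
      omega
    · have := F.dist_le_height_add u s hu.symm
      rw [F.dist_of_root_ne (u := t) (by rw [hu]; exact Ne.symm hroot)] at e
      omega
    · have := F.dist_le_height_add t s ht.symm
      rw [F.dist_of_root_ne (u := u) (by rw [ht]; exact hroot)] at e
      omega

variable (F) in
/-- The members of a resolving set hang neither from one cycle vertex nor from two antipodal
ones. -/
theorem exists_root_ne_of_isResolvingSet (hg : 4 ≤ g) {S : Finset V} (hS : G.IsResolvingSet S) :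
    ∃ p ∈ S, ∃ q ∈ S, F.root p ≠ F.root q ∧ 2 * cycDist g (F.root p) (F.root q) ≠ g := by
  by_contra! hn
  have hcne : ∀ i < g, ∀ j < g, i ≠ j → F.c i ≠ F.c j := fun i hi j hj hij h =>
    hij (by rw [← F.root_c i hi, h, F.root_c j hj])
  obtain ⟨s₀, hs₀, -⟩ := hS _ _ (hcne 0 (by omega) 1 (by omega) (by omega))
  have ha := F.root_lt s₀
  -- `l` and `m` are the cycle neighbors of the root of `s₀`. Members hanging there or at its
  -- antipode are equidistant from both.
  obtain ⟨l, hl⟩ : ∃ l, (F.root s₀ + 1 < g ∧ l = F.root s₀ + 1) ∨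
      (F.root s₀ + 1 = g ∧ l = 0) := by
    by_cases h : F.root s₀ + 1 < g
    · exact ⟨_, .inl ⟨h, rfl⟩⟩
    · exact ⟨0, .inr ⟨by omega, rfl⟩⟩
  obtain ⟨m, hm⟩ : ∃ m, m + 1 = F.root s₀ ∨ (F.root s₀ = 0 ∧ m + 1 = g) := by
    by_cases h : F.root s₀ = 0
    · exact ⟨g - 1, .inr ⟨h, by omega⟩⟩
    · exact ⟨F.root s₀ - 1, .inl (by omega)⟩
  have hlg : l < g := by omega
  have hmg : m < g := by omega
  obtain ⟨s, hs, hr⟩ := hS _ _ (hcne l hlg m hmg (by omega))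
  have h1 : F.root s₀ = F.root s ∨ 2 * cycDist g (F.root s₀) (F.root s) = g := by
    by_cases h : F.root s₀ = F.root s
    · exact .inl h
    · exact .inr (hn s₀ hs₀ s hs h)
  have hsg := F.root_lt s
  refine hr ?_
  have hd : cycDist g l (F.root s) = cycDist g m (F.root s) ∧ l ≠ F.root s ∧ m ≠ F.root s := by
    simp only [cycDist] at *
    omega
  rw [F.dist_of_root_ne (by rw [F.root_c l hlg]; exact hd.2.1),
    F.dist_of_root_ne (by rw [F.root_c m hmg]; exact hd.2.2), F.root_c l hlg, F.root_c m hmg,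
    F.height_c l hlg, F.height_c m hmg, hd.1]

/-- Seen from outside the branch, distances to `x` and `z` differ by a constant. Inside it, `y`
compares heights. Mixed pairs are resolved by `y` or `z`, which lie on opposite sides of the edge
above `v`. -/
theorem isResolvingSet_insert_of_mem_branch [DecidableEq V] {S : Finset V}
    (hS : G.IsResolvingSet S) {x y v z : V} (hx : F.Desc v x) (hz : F.Desc v z)
    (hv : F.height v ≠ 0) (hR : ∀ s ∈ S.erase x, ¬ F.Desc v s) (hy : y ∈ S.erase x)
    (hpath : ∀ u t, F.Desc v u → F.Desc v t → F.height u = F.height t → u = t) :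
    G.IsResolvingSet (insert z (S.erase x)) := by
  have mixed : ∀ u t, F.Desc v u → ¬ F.Desc v t →
      G.Resolves y u t ∨ G.Resolves z u t := by
    intro u t hu ht
    by_contra! hn
    unfold Resolves at hn
    have e1 := hu.dist_eq hv (hR y hy)
    have e2 := hz.dist_eq hv ht
    have e3 := F.connected.dist_triangle (u := t) (v := F.parent v) (w := y)
    have e4 := F.connected.dist_triangle (u := u) (v := v) (w := z)
    rw [dist_comm (u := v) (v := z)] at e4
    rw [dist_comm (u := z), dist_comm (u := F.parent v) (v := t)] at e2
    omega
  intro u t hut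
  by_cases hu : F.Desc v u <;> by_cases ht : F.Desc v t
  · refine ⟨y, Finset.mem_insert_of_mem hy, fun he => hut (hpath u t hu ht ?_)⟩
    rw [hu.dist_eq hv (hR y hy), ht.dist_eq hv (hR y hy)] at he
    unfold Desc at hu ht
    omega
  · rcases mixed u t hu ht with h | h
    exacts [⟨y, by simp_all, h⟩, ⟨z, by simp, h⟩]
  · rcases mixed t u ht hu with h | h
    exacts [⟨y, by simp_all, h.symm⟩, ⟨z, by simp, h.symm⟩]
  · obtain ⟨s, hs, hr⟩ := hS u t hut
    by_cases hsx : s = x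
    · subst hsx
      refine ⟨z, by simp, fun he => hr ?_⟩
      rw [dist_comm, hz.dist_eq hv hu, dist_comm (u := t), hz.dist_eq hv ht] at he
      rw [dist_comm, hx.dist_eq hv hu, dist_comm (u := t), hx.dist_eq hv ht]
      omega
    · exact ⟨s, by simp [hs, hsx], hr⟩

/-- Here the branch of `v₁` is a single vertex. From outside both branches `v₁` and `v₂` are equally
far, and from inside the branch of `v₂` the way to `v₁` passes `v₂`. Pairs containing `v₁` need a
separate argument. -/
theorem isResolvingSet_insert_sibling [DecidableEq V] {S : Finset V}
    (hS : G.IsResolvingSet S) {y v₁ v₂ : V} (hne : v₁ ≠ v₂) (h₁ : F.height v₁ ≠ 0)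
    (h₂ : F.height v₂ ≠ 0) (hp : F.parent v₁ = F.parent v₂)
    (hR₁ : ∀ s ∈ S.erase v₁, ¬ F.Desc v₁ s) (hR₂ : ∀ s ∈ S.erase v₁, ¬ F.Desc v₂ s)
    (hy : y ∈ S.erase v₁) (hsingle : ∀ u, F.Desc v₁ u → u = v₁) :
    G.IsResolvingSet (insert v₂ (S.erase v₁)) := by
  have hout₁ : ∀ t, t ≠ v₁ → G.dist v₁ t = 1 + G.dist (F.parent v₂) t := fun t ht => by
    have := (desc_refl v₁).dist_eq h₁ (z := t) (fun h => ht (hsingle t h))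
    rw [this, hp]; simp
  have hout₂ : ∀ t, ¬ F.Desc v₂ t → G.dist v₂ t = 1 + G.dist (F.parent v₂) t := fun t ht => by
    have := (desc_refl v₂).dist_eq h₂ ht
    rw [this]; simp
  have hd₂ : ¬ F.Desc v₂ v₁ := not_desc_of_siblings hne h₁ h₂ hp (desc_refl v₁)
  have h12 := hout₂ v₁ hd₂
  have hp1 := F.dist_parent h₁
  rw [dist_comm, hp] at hp1
  have first : ∀ t, t ≠ v₁ → ∃ s ∈ insert v₂ (S.erase v₁), G.Resolves s v₁ t := by
    intro t ht
    by_contra! hn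
    replace hn : ∀ s ∈ insert v₂ (S.erase v₁), G.dist v₁ s = G.dist t s :=
      fun s hs => not_not.1 (hn s hs)
    have e2 := hn v₂ (by simp)
    rw [dist_comm] at e2
    have htv : v₂ ≠ t := by
      rintro rfl
      rw [dist_self] at e2
      omega
    by_cases htd : F.Desc v₂ t
    · have e1 := hn y (by simp_all)
      rw [htd.dist_eq h₂ (hR₂ y hy), hout₁ y (by rintro rfl; simp at hy)] at e1
      have := F.connected.pos_dist_of_ne htv
      rw [dist_comm] at this
      omega
    -- A member other than `v₁` is equally far from `v₁` and `v₂`, so if it resolves `v₂` and `t`,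
    -- it also resolves `v₁` and `t`.
    · obtain ⟨s, hs, hr⟩ := hS v₂ t htv
      by_cases hsv : s = v₁
      · subst hsv
        have e3 := hout₁ t ht
        have e4 := hout₂ t htd
        rw [dist_comm (v := t)] at e3
        rw [dist_comm] at e4
        unfold Resolves at hr
        omega
      · have hs' : s ∈ S.erase v₁ := by simp [hs, hsv]
        have := hn s (by simp [hs, hsv])
        refine hr ?_
        rw [hout₂ s (hR₂ s hs'), ← this, hout₁ s hsv]
  have mixed : ∀ u t, F.Desc v₂ u → ¬ F.Desc v₂ t →
      G.Resolves y u t ∨ G.Resolves v₂ u t := by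
    intro u t hu ht
    by_contra! hn
    unfold Resolves at hn
    have e1 := hu.dist_eq h₂ (hR₂ y hy)
    have e2 := hout₂ t ht
    have e3 := F.connected.dist_triangle (u := t) (v := F.parent v₂) (w := y)
    rw [dist_comm, dist_comm (u := F.parent v₂)] at e2
    omega
  intro u t hut
  by_cases hu₁ : u = v₁
  · subst hu₁
    exact first t hut.symm
  by_cases ht₁ : t = v₁
  · subst ht₁
    obtain ⟨s, hs, h⟩ := first u hut
    exact ⟨s, hs, h.symm⟩
  by_cases hu : F.Desc v₂ u <;> by_cases ht : F.Desc v₂ t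
  · obtain ⟨s, hs, hr⟩ := hS u t hut
    by_cases hsx : s = v₁
    · subst hsx
      refine ⟨v₂, by simp, fun he => hr ?_⟩
      rw [hu.dist_eq h₂ hd₂, ht.dist_eq h₂ hd₂, he]
    · exact ⟨s, by simp [hs, hsx], hr⟩
  · rcases mixed u t hu ht with h | h
    exacts [⟨y, by simp_all, h⟩, ⟨v₂, by simp, h⟩]
  · rcases mixed t u ht hu with h | h
    exacts [⟨y, by simp_all, h.symm⟩, ⟨v₂, by simp, h.symm⟩]
  · obtain ⟨s, hs, hr⟩ := hS u t hut
    by_cases hsx : s = v₁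
    · subst hsx
      refine ⟨v₂, by simp, fun he => hr ?_⟩
      rw [dist_comm, hout₂ u hu, dist_comm (u := t), hout₂ t ht] at he
      rw [dist_comm, hout₁ u hu₁, dist_comm (u := t), hout₁ t ht₁]
      omega
    · exact ⟨s, by simp [hs, hsx], hr⟩

/-- Take a highest pair of sibling branches missed by `S.erase x`; one of them contains `x`. By
maximality it does not ramify. Exchange `x` within it, or for the sibling if `x` is all of it. -/
theorem exists_insert_of_not_isBranchResolving [Fintype V] [DecidableEq V] {S : Finset V}
    (hS : G.IsResolvingSet S) {x y : V} (hy : y ∈ S.erase x)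
    (hB : ¬ F.IsBranchResolving (S.erase x)) :
    ∃ z, z ≠ x ∧ G.IsResolvingSet (insert z (S.erase x)) := by
  classical
  let P : V × V → Prop := fun v => v.1 ≠ v.2 ∧ F.height v.1 ≠ 0 ∧ F.height v.2 ≠ 0 ∧
    F.parent v.1 = F.parent v.2 ∧ ∀ s ∈ S.erase x, ¬ F.Desc v.1 s ∧ ¬ F.Desc v.2 s
  have hne : (Finset.univ.filter P).Nonempty := by
    unfold IsBranchResolving at hB
    push Not at hB
    obtain ⟨v₁, v₂, h⟩ := hB
    exact ⟨(v₁, v₂), by simpa [P] using h⟩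
  obtain ⟨⟨v₁, v₂⟩, hv, hmax⟩ := Finset.exists_max_image _ (fun v : V × V => F.height v.1) hne
  replace hv : P (v₁, v₂) := (Finset.mem_filter.1 hv).2
  replace hmax : ∀ w₁ w₂, P (w₁, w₂) → F.height w₁ ≤ F.height v₁ := fun w₁ w₂ h =>
    hmax (w₁, w₂) (by simpa using h)
  wlog hx : F.Desc v₁ x generalizing v₁ v₂
  · obtain ⟨h1, h2, h3, h4, h5⟩ := hv
    have hh : F.height v₁ = F.height v₂ := by
      rw [F.height_parent v₁ h2, F.height_parent v₂ h3, h4]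
    refine this v₂ v₁ ⟨h1.symm, h3, h2, h4.symm, fun s hs => (h5 s hs).symm⟩
      (fun w₁ w₂ hw => by rw [← hh]; exact hmax w₁ w₂ hw) ?_
    obtain ⟨s, hs, hd⟩ := F.isBranchResolving hS v₁ v₂ h1 h2 h3 h4
    by_cases hsx : s = x
    · subst hsx
      exact hd.resolve_left hx
    · have := h5 s (by simp [hs, hsx])
      tauto
  obtain ⟨h1, h2, h3, h4, h5⟩ := hv
  have hpath : ∀ u t, F.Desc v₁ u → F.Desc v₁ t → F.height u = F.height t → u = t := by
    intro u t hu ht hh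
    by_contra hut
    obtain ⟨w₁, w₂, k1, k2, k3, k4, k5, k6⟩ :=
      exists_siblings hut hh (hu.root_eq.trans ht.root_eq.symm)
    have e1 := F.height_parent w₁ k2
    have e2 := F.height_parent w₂ k3
    rw [← k4] at e2
    rcases Nat.lt_or_ge (F.height v₁) (F.height w₁) with hlt | hge
    · have d1 := hu.nested k5 hlt.le h2
      have d2 := ht.nested k6 (by omega) h2
      have := hmax w₁ w₂ ⟨k1, k2, k3, k4, fun s hs =>
        ⟨fun h => (h5 s hs).1 (d1.trans h), fun h => (h5 s hs).1 (d2.trans h)⟩⟩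
      omega
    · have d1 := k5.nested hu hge k2
      have d2 := k6.nested ht (by omega) k3
      exact not_desc_of_siblings k1 k2 k3 k4 d1 d2
  by_cases hz : ∃ z, F.Desc v₁ z ∧ z ≠ x
  · obtain ⟨z, hz, hzx⟩ := hz
    exact ⟨z, hzx, isResolvingSet_insert_of_mem_branch hS hx hz h2 (fun s hs => (h5 s hs).1) hy
      hpath⟩
  · push Not at hz
    obtain rfl := hz v₁ (desc_refl v₁)
    exact ⟨v₂, h1.symm, isResolvingSet_insert_sibling hS h1 h2 h3 h4 (fun s hs => (h5 s hs).1)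
      (fun s hs => (h5 s hs).2) hy hz⟩

end CycleFrame

/-! ### The frame of a unicyclic graph -/

variable {V : Type*} {G : SimpleGraph V}

theorem IsUnicyclic.mem_edges_iff (hG : G.IsUnicyclic) {u v : V} {p : G.Walk u u} {q : G.Walk v v}
    (hp : p.IsCycle) (hq : q.IsCycle) (e : Sym2 V) : e ∈ q.edges ↔ e ∈ p.edges := by
  obtain ⟨C, -, hC⟩ := hG.2
  have h : {e | e ∈ q.edges} = {e | e ∈ p.edges} :=
    (hC _ ⟨v, q, hq, rfl⟩).trans (hC _ ⟨u, p, hp, rfl⟩).symm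
  exact Set.ext_iff.1 h e

theorem IsUnicyclic.isBridge (hG : G.IsUnicyclic) {u v w : V} {p : G.Walk u u}
    (hp : p.IsCycle) (hvw : G.Adj v w) (he : s(v, w) ∉ p.edges) : G.IsBridge s(v, w) :=
  (isBridge_iff_forall_cycle_notMem hvw).2 fun _ _ hq h => he ((hG.mem_edges_iff hp hq _).1 h)

theorem IsUnicyclic.mem_cycleVertices_iff (hG : G.IsUnicyclic) {u : V} {p : G.Walk u u}
    (hp : p.IsCycle) (v : V) : v ∈ G.cycleVertices ↔ v ∈ p.support := by
  refine ⟨?_, fun h => ⟨u, p, hp, h⟩⟩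
  rintro ⟨w, q, hq, hv⟩
  rw [Walk.mem_support_iff_exists_mem_edges_of_not_nil hq.not_nil] at hv
  rw [Walk.mem_support_iff_exists_mem_edges_of_not_nil hp.not_nil]
  obtain ⟨e, he, hve⟩ := hv
  exact ⟨e, (hG.mem_edges_iff hp hq e).1 he, hve⟩

theorem Walk.exists_walk_of_mem_support {u a b : V} (p : G.Walk u u) (ha : a ∈ p.support)
    (hb : b ∈ p.support) :
    ∃ q : G.Walk a b, q.edges ⊆ p.edges ∧ q.support ⊆ p.support := by
  classical
  refine ⟨(p.takeUntil a ha).reverse.append (p.takeUntil b hb), fun e he => ?_, fun v hv => ?_⟩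
  · rw [Walk.edges_append, List.mem_append, Walk.edges_reverse, List.mem_reverse] at he
    rcases he with he | he
    exacts [p.edges_takeUntil_subset_edges ha he, p.edges_takeUntil_subset_edges hb he]
  · rw [Walk.mem_support_append_iff, Walk.support_reverse, List.mem_reverse] at hv
    rcases hv with hv | hv
    exacts [p.support_takeUntil_subset_support ha hv, p.support_takeUntil_subset_support hb hv]

/-- Outside the cycle, at most one neighbor of a vertex reaches the cycle avoiding this vertex. -/
theorem IsUnicyclic.eq_of_walks (hG : G.IsUnicyclic) {u v w₁ w₂ a₁ a₂ : V} {p : G.Walk u u}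
    (hp : p.IsCycle) (hv : v ∉ p.support) (h₁ : G.Adj v w₁) (h₂ : G.Adj v w₂)
    (ha₁ : a₁ ∈ p.support) (ha₂ : a₂ ∈ p.support) (q₁ : G.Walk w₁ a₁) (q₂ : G.Walk w₂ a₂)
    (hq₁ : v ∉ q₁.support) (hq₂ : v ∉ q₂.support) : w₁ = w₂ := by
  by_contra hne
  have hb := hG.isBridge hp h₁.symm (fun h => hv (p.snd_mem_support_of_mem_edges h))
  obtain ⟨q, -, hq⟩ := p.exists_walk_of_mem_support ha₁ ha₂
  -- A walk from `w₁` to `v` via the cycle and `w₂` would have to use the bridge `w₁v`.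
  have := isBridge_iff_forall_walk_mem_edges.1 hb
    (((q₁.append q).append q₂.reverse).append (Walk.cons h₂.symm Walk.nil))
  simp only [Walk.edges_append, List.mem_append, Walk.edges_reverse, List.mem_reverse,
    Walk.edges_cons, Walk.edges_nil, List.mem_cons, List.not_mem_nil, or_false] at this
  rcases this with ((h | h) | h) | h
  · exact hq₁ (q₁.snd_mem_support_of_mem_edges h)
  · exact hv (hq (q.snd_mem_support_of_mem_edges h))
  · exact hq₂ (q₂.snd_mem_support_of_mem_edges h)
  · rw [Sym2.congr_left] at h
    exact hne h

/-- A chord would be a bridge, yet the cycle joins its ends. -/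
theorem IsUnicyclic.adj_getVert_iff (hG : G.IsUnicyclic) {u : V} {p : G.Walk u u}
    (hp : p.IsCycle) {i j : ℕ} (hi : i < p.length) (hj : j < p.length) :
    G.Adj (p.getVert i) (p.getVert j) ↔ cycDist p.length i j = 1 := by
  have h3 := hp.three_le_length
  have hinj : ∀ i j, i < p.length → j < p.length → p.getVert i = p.getVert j → i = j :=
    fun i j hi hj h => hp.getVert_injOn' (show i ≤ p.length - 1 by omega)
      (show j ≤ p.length - 1 by omega) h
  have hlast : p.getVert p.length = p.getVert 0 := by simp
  constructor
  · intro hadj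
    by_cases he : s(p.getVert i, p.getVert j) ∈ p.edges
    · obtain ⟨k, hk, he⟩ := (p.mk_mem_edges_iff_exists).1 he
      have hs : ∃ k', k' < p.length ∧ p.getVert (k + 1) = p.getVert k' ∧
          (k' = k + 1 ∨ k + 1 = p.length ∧ k' = 0) := by
        by_cases hk' : k + 1 < p.length
        · exact ⟨k + 1, hk', rfl, .inl rfl⟩
        · have hk1 : k + 1 = p.length := by omega
          exact ⟨0, by omega, by rw [hk1, hlast], .inr ⟨hk1, rfl⟩⟩
      obtain ⟨k', hk', e', hc⟩ := hs
      rw [e', Sym2.eq_iff] at he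
      rcases he with ⟨e1, e2⟩ | ⟨e1, e2⟩
      · have f1 := hinj _ _ hk hi e1
        have f2 := hinj _ _ hk' hj e2
        simp only [cycDist]; omega
      · have f1 := hinj _ _ hk hj e1
        have f2 := hinj _ _ hk' hi e2
        simp only [cycDist]; omega
    · have hb := hG.isBridge hp hadj he
      obtain ⟨q, hq, -⟩ := p.exists_walk_of_mem_support (p.getVert_mem_support i)
        (p.getVert_mem_support j)
      exact absurd (hq (isBridge_iff_forall_walk_mem_edges.1 hb q)) he
  · intro hd
    wlog hij : i ≤ j generalizing i j
    · exact (this hj hi (by rwa [cycDist_comm]) (by omega)).symm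
    have hc : j = i + 1 ∨ i = 0 ∧ j + 1 = p.length := by
      simp only [cycDist] at hd; omega
    rcases hc with rfl | ⟨rfl, h⟩
    · exact p.adj_getVert_succ hi
    · have := p.adj_getVert_succ hj
      rw [h, hlast] at this
      exact this.symm

theorem IsUnicyclic.exists_cycleFrame (hG : G.IsUnicyclic) :
    ∃ F : G.CycleFrame G.girth, ∀ v, v ∈ G.cycleVertices ↔ F.height v = 0 := by
  have hcyc : ¬ G.IsAcyclic := by
    obtain ⟨C, ⟨u, p, hp, -⟩, -⟩ := hG.2
    exact fun h => h p hp
  obtain ⟨u, p, hp, hlen⟩ := exists_girth_eq_length.2 hcyc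
  rw [hlen]
  have h3 := hp.three_le_length
  have hconn := hG.1
  have hmem : ∀ v, v ∈ p.support ↔ ∃ i < p.length, p.getVert i = v := by
    intro v
    rw [Walk.mem_support_iff_exists_getVert]
    constructor
    · rintro ⟨i, hi, hil⟩
      rcases hil.lt_or_eq with h | rfl
      · exact ⟨i, h, hi⟩
      · exact ⟨0, by omega, by rw [← hi]; simp⟩
    · rintro ⟨i, hi, h⟩
      exact ⟨i, h, hi.le⟩
  have hnear : ∀ v, ∃ i < p.length, ∀ j < p.length,
      G.dist v (p.getVert i) ≤ G.dist v (p.getVert j) := by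
    intro v
    obtain ⟨i, hi, h⟩ := Finset.exists_min_image (Finset.range p.length)
      (fun i => G.dist v (p.getVert i)) ⟨0, by simp; omega⟩
    exact ⟨i, by simpa using hi, fun j hj => h j (by simpa using hj)⟩
  choose near hlt hmin using hnear
  set height : V → ℕ := fun v => G.dist v (p.getVert (near v))
  have hle : ∀ v, ∀ j < p.length, height v ≤ G.dist v (p.getVert j) := hmin
  have hzero : ∀ v, height v = 0 ↔ v ∈ p.support := by
    intro v
    rw [hmem]
    constructor
    · intro h
      exact ⟨near v, hlt v, ((hconn.dist_eq_zero_iff).1 h).symm⟩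
    · rintro ⟨i, hi, rfl⟩
      have := hle (p.getVert i) i hi
      rw [dist_self] at this
      omega
  have hpar : ∀ v, ∃ w, height v ≠ 0 → G.Adj v w ∧ height v = height w + 1 := by
    intro v
    have step : ∀ b, ∃ w, G.dist v b ≠ 0 → G.Adj v w ∧ G.dist w b + 1 ≤ G.dist v b := by
      intro b
      obtain ⟨q, hq⟩ := hconn.exists_walk_length_eq_dist v b
      cases q with
      | nil => exact ⟨v, fun h => absurd (by simp) h⟩
      | @cons _ w _ hadj r =>
        rw [← hq]
        exact ⟨w, fun _ => ⟨hadj, Nat.succ_le_succ (dist_le r)⟩⟩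
    obtain ⟨w, hw⟩ := step (p.getVert (near v))
    refine ⟨w, fun h0 => ?_⟩
    obtain ⟨hadj, h1⟩ := hw h0
    have h2 := hle w (near v) (hlt v)
    have h4 := hle v (near w) (hlt w)
    have h5 := hconn.dist_triangle (u := v) (v := w) (w := p.getVert (near w))
    rw [dist_eq_one_iff_adj.2 hadj] at h5
    have h6 : height w = G.dist w (p.getVert (near w)) := rfl
    have h7 : height v = G.dist v (p.getVert (near v)) := rfl
    exact ⟨hadj, by omega⟩
  choose parent hparent using hpar
  -- A shortest walk from `w` to the cycle gets strictly closer to it, so it cannot meet `v`, which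
  -- is at least as far as `w`.
  have hwalk : ∀ v w, v ≠ w → height w ≤ height v →
      ∃ q : G.Walk w (p.getVert (near w)), v ∉ q.support := by
    classical
    intro v w hne hwv
    obtain ⟨q, hq⟩ := hconn.exists_walk_length_eq_dist w (p.getVert (near w))
    refine ⟨q, fun hv => ?_⟩
    have h1 := hle v (near w) (hlt w)
    have h2 := dist_le (q.dropUntil v hv)
    have h3 := congrArg Walk.length (q.take_spec hv)
    have h4 := hconn.pos_dist_of_ne hne
    have h5 := dist_le (q.takeUntil v hv)
    rw [dist_comm] at h5
    rw [Walk.length_append] at h3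
    have h6 : height w = G.dist w (p.getVert (near w)) := rfl
    omega
  have hinj : ∀ i j, i < p.length → j < p.length → p.getVert i = p.getVert j → i = j :=
    fun i j hi hj h => hp.getVert_injOn' (show i ≤ p.length - 1 by omega)
      (show j ≤ p.length - 1 by omega) h
  have hhc : ∀ i < p.length, height (p.getVert i) = 0 := fun i hi =>
    (hzero _).2 (p.getVert_mem_support i)
  have hnear0 : ∀ v, height v = 0 → p.getVert (near v) = v := fun v h =>
    ((hconn.dist_eq_zero_iff).1 h).symm
  refine ⟨{
    c := p.getVert
    height := height
    parent := parent
    -- Climbing to the cycle, instead of choosing a nearest vertex, makes the root invariant under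
    -- `parent` by unfolding.
    root := fun v => near (parent^[height v] v)
    connected := hconn
    root_lt := fun v => hlt _
    root_c := fun i hi => hinj _ _ (hlt _) hi (by
      simp only [hhc i hi, Function.iterate_zero, id]; exact hnear0 _ (hhc i hi))
    height_c := hhc
    c_root := fun v h => by simp only [h, Function.iterate_zero, id]; exact hnear0 v h
    adj_c := fun i hi j hj => hG.adj_getVert_iff hp hi hj
    adj_parent := fun v h => (hparent v h).1
    height_parent := fun v h => (hparent v h).2
    eq_parent := fun v w h hadj hwv => by
      obtain ⟨hadj', hh⟩ := hparent v h
      obtain ⟨q₁, hq₁⟩ := hwalk v w hadj.ne hwv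
      obtain ⟨q₂, hq₂⟩ := hwalk v (parent v) hadj'.ne (by omega)
      exact hG.eq_of_walks hp (fun hv => h ((hzero v).2 hv)) hadj hadj'
        (p.getVert_mem_support _) (p.getVert_mem_support _) q₁ q₂ hq₁ hq₂
    root_parent := fun v h => by
      rw [(hparent v h).2, Function.iterate_succ_apply] }, fun v => ?_⟩
  rw [hG.mem_cycleVertices_iff hp]
  exact (hzero v).symm

/-! ### Metric bases and forced vertices -/

theorem isResolvingSet_univ [Fintype V] (hG : G.Connected) : G.IsResolvingSet Finset.univ := by
  intro u v huv
  refine ⟨u, Finset.mem_univ u, ?_⟩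
  have := hG.pos_dist_of_ne huv.symm
  unfold Resolves
  rw [dist_self]
  omega

theorem exists_isMetricBasis [Fintype V] (hG : G.Connected) : ∃ S, G.IsMetricBasis S :=
  Nat.sInf_mem (s := {n | ∃ S : Finset V, G.IsResolvingSet S ∧ S.card = n})
    ⟨_, Finset.univ, isResolvingSet_univ hG, rfl⟩

/-- The exchanged set is no larger than `S`, so it would be a basis without `x`. -/
theorem IsBasisForced.not_isResolvingSet_insert [DecidableEq V] {x z : V} {S : Finset V}
    (hx : G.IsBasisForced x) (hS : G.IsMetricBasis S) (hz : z ≠ x) :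
    ¬ G.IsResolvingSet (insert z (S.erase x)) := by
  intro h
  have hxS := hx S hS
  have h1 : G.metricDim ≤ (insert z (S.erase x)).card := Nat.sInf_le ⟨_, h, rfl⟩
  have h2 := Finset.card_insert_le z (S.erase x)
  rw [Finset.card_erase_add_one hxS, hS.2] at h2
  have h3 := hx _ ⟨h, le_antisymm h2 h1⟩
  simp [hz.symm] at h3

namespace CycleFrame

variable {g : ℕ} (F : G.CycleFrame g)

theorem isBranchResolving_erase [Fintype V] [DecidableEq V] {x y : V} {S : Finset V}
    (hx : G.IsBasisForced x) (hS : G.IsMetricBasis S) (hy : y ∈ S.erase x) :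
    F.IsBranchResolving (S.erase x) := by
  by_contra hB
  obtain ⟨z, hz, h⟩ := exists_insert_of_not_isBranchResolving hS.1 hy hB
  exact hx.not_isResolvingSet_insert hS hz h

theorem roots_of_isBasisForced [Fintype V] [DecidableEq V] (hg : 4 ≤ g) {x p q : V} {S : Finset V}
    (hx : G.IsBasisForced x) (hS : G.IsMetricBasis S) (hp : p ∈ S.erase x) (hq : q ∈ S.erase x)
    (hpq : F.root p ≠ F.root q) (hne : 2 * cycDist g (F.root p) (F.root q) ≠ g) :
    g % 2 = 1 ∧ cycDist g (F.root p) (F.root q) = 1 ∧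
      IsGeodesicTriple g (F.root p) (F.root q) (F.root x) ∧ x = F.c (F.root x) := by
  obtain ⟨m₁, m₂, hm₁, hm₂, hm, hT₁, hT₂⟩ :=
    exists_isGeodesicTriple hg (F.root_lt p) (F.root_lt q) hpq hne
  have hB := F.isBranchResolving_erase hx hS hp
  have key : ∀ m < g, IsGeodesicTriple g (F.root p) (F.root q) m → F.c m = x := by
    intro m hm hT
    by_contra hmx
    refine hx.not_isResolvingSet_insert hS hmx ?_
    refine (hB.mono (Finset.subset_insert _ _)).isResolvingSet
      (Finset.mem_insert_of_mem hp) (Finset.mem_insert_of_mem hq)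
      (Finset.mem_insert_self (F.c m) _) hpq hne ?_
    rwa [F.root_c m hm]
  have e₁ := key m₁ hm₁ hT₁
  have e₂ := key m₂ hm₂ hT₂
  have hr : F.root x = m₁ := by rw [← e₁, F.root_c m₁ hm₁]
  obtain ⟨h1, h2⟩ := hm (by rw [← F.root_c m₁ hm₁, e₁, ← e₂, F.root_c m₂ hm₂])
  exact ⟨h1, h2, by rwa [hr], by rw [hr, e₁]⟩

/-- Two forced vertices are the only pair of roots in a metric basis that is neither equal nor
antipodal. -/
theorem mem_pair_of_isBasisForced [Fintype V] (hg : 4 ≤ g) {x y p q : V}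
    {S : Finset V} (hx : G.IsBasisForced x) (hy : G.IsBasisForced y) (hxy : x ≠ y)
    (hS : G.IsMetricBasis S) (hp : p ∈ S) (hq : q ∈ S) (hpq : F.root p ≠ F.root q)
    (hne : 2 * cycDist g (F.root p) (F.root q) ≠ g) : x = p ∨ x = q := by
  classical
  by_contra! hn
  have hxS := hx S hS
  have hyS := hy S hS
  obtain ⟨h1, h2, h3, h4⟩ := F.roots_of_isBasisForced hg hx hS
    (Finset.mem_erase.2 ⟨hn.1.symm, hp⟩) (Finset.mem_erase.2 ⟨hn.2.symm, hq⟩) hpq hne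
  have c1 := cycDist_comm g (F.root p) (F.root q)
  have c2 := cycDist_comm g (F.root p) (F.root x)
  have hlp := F.root_lt p
  have hlq := F.root_lt q
  have hlx := F.root_lt x
  -- Since `g` is odd and both distances to the root of `x` sum to `g - 1`, each is `(g - 1) / 2`.
  -- For `r` in `{p, q}` other than `y`, the pair `r`, `x` avoids `y`, so this distance is 1 and `g
  -- = 3`.
  have b1 : 2 * cycDist g (F.root p) (F.root x) ≤ g := by simp only [cycDist]; omega
  have b2 : 2 * cycDist g (F.root q) (F.root x) ≤ g := by simp only [cycDist]; omega
  unfold IsGeodesicTriple at h3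
  have aux : ∀ r, r ∈ S → r ≠ y → r ≠ x → 2 * cycDist g (F.root r) (F.root x) + 1 = g → False := by
    intro r hr hry hrx hd
    have hrx' : F.root r ≠ F.root x := by
      intro h
      rw [h, cycDist_self] at hd
      omega
    have := (F.roots_of_isBasisForced hg hy hS (Finset.mem_erase.2 ⟨hry, hr⟩)
      (Finset.mem_erase.2 ⟨hxy, hxS⟩) hrx' (by omega)).2.1
    omega
  by_cases hyp : p = y
  · refine aux q hq ?_ hn.2.symm (by omega)
    rintro rfl
    exact hpq (by rw [hyp])
  · exact aux p hp hyp hn.1.symm (by omega)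

theorem eq_pair_of_isBasisForced [Fintype V] [DecidableEq V] (hg : 4 ≤ g) {x y : V}
    {S : Finset V} (hx : G.IsBasisForced x) (hy : G.IsBasisForced y) (hxy : x ≠ y)
    (hS : G.IsMetricBasis S) : S = {x, y} ∧ F.root x ≠ F.root y := by
  have hxS := hx S hS
  have hyS := hy S hS
  have pair : ∀ p ∈ S, ∀ q ∈ S, F.root p ≠ F.root q →
      2 * cycDist g (F.root p) (F.root q) ≠ g → (x = p ∨ x = q) ∧ (y = p ∨ y = q) :=
    fun p hp q hq h h' => ⟨F.mem_pair_of_isBasisForced hg hx hy hxy hS hp hq h h',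
      F.mem_pair_of_isBasisForced hg hy hx hxy.symm hS hp hq h h'⟩
  obtain ⟨p, hp, q, hq, hpq, hne⟩ := F.exists_root_ne_of_isResolvingSet hg hS.1
  have hroot : F.root x ≠ F.root y ∧ 2 * cycDist g (F.root x) (F.root y) ≠ g := by
    obtain ⟨rfl | rfl, rfl | rfl⟩ := pair p hp q hq hpq hne
    · exact absurd rfl hxy
    · exact ⟨hpq, hne⟩
    · exact ⟨hpq.symm, by rwa [cycDist_comm]⟩
    · exact absurd rfl hxy
  refine ⟨?_, hroot.1⟩
  ext s
  simp only [Finset.mem_insert, Finset.mem_singleton]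
  refine ⟨fun hs => ?_, by rintro (rfl | rfl) <;> assumption⟩
  by_contra! hn
  -- A third member would have its root equal or antipodal to those of both `x` and `y`, making
  -- these two equal or antipodal.
  have anti : ∀ z ∈ S, (x = z ∨ y = z) → F.root s = F.root z ∨
      2 * cycDist g (F.root s) (F.root z) = g := by
    intro z hz hzz
    by_contra! h
    obtain ⟨h1, h2⟩ := pair s hs z hz h.1 h.2
    rcases hzz with rfl | rfl
    · rcases h2 with h2 | h2
      exacts [hn.2 h2.symm, hxy h2.symm]
    · rcases h1 with h1 | h1
      exacts [hn.1 h1.symm, hxy h1]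
  have a1 := anti x hxS (.inl rfl)
  have a2 := anti y hyS (.inr rfl)
  have l1 := F.root_lt x
  have l2 := F.root_lt y
  have l3 := F.root_lt s
  rcases a1 with a1 | a1 <;> rcases a2 with a2 | a2
  · exact hroot.1 (a1.symm.trans a2)
  · rw [a1] at a2
    exact hroot.2 a2
  · rw [a2, cycDist_comm] at a1
    exact hroot.2 a1
  · have h1 := hroot.1
    simp only [cycDist] at a1 a2
    omega

theorem exists_children [Fintype V] [DecidableRel G.Adj] {w : V} {A : Finset V}
    (hA : A.card + 2 ≤ G.degree w)
    (h : ∀ t, G.Adj w t → t ∈ A ∨ F.height t ≠ 0 ∧ F.parent t = w) :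
    ∃ v₁ v₂, v₁ ≠ v₂ ∧ F.height v₁ ≠ 0 ∧ F.height v₂ ≠ 0 ∧ F.parent v₁ = w ∧
      F.parent v₂ = w := by
  classical
  have h1 := Finset.le_card_sdiff A (G.neighborFinset w)
  rw [card_neighborFinset_eq_degree] at h1
  obtain ⟨v₁, hv₁, v₂, hv₂, hne⟩ := Finset.one_lt_card.1
    (show 1 < (G.neighborFinset w \ A).card by omega)
  rw [Finset.mem_sdiff, mem_neighborFinset] at hv₁ hv₂
  have k₁ := (h v₁ hv₁.1).resolve_left hv₁.2
  have k₂ := (h v₂ hv₂.1).resolve_left hv₂.2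
  exact ⟨v₁, v₂, hne, k₁.1, k₂.1, k₁.2, k₂.2⟩

/-- The degree bounds 4 and 3 exceed by two the neighbors that are not children: two on the cycle,
or the parent. -/
theorem exists_children_of_isBranching [Fintype V] [DecidableRel G.Adj]
    (hF : ∀ v, v ∈ G.cycleVertices ↔ F.height v = 0) {w : V} (hw : G.IsBranching w) :
    ∃ v₁ v₂, v₁ ≠ v₂ ∧ F.height v₁ ≠ 0 ∧ F.height v₂ ≠ 0 ∧ F.parent v₁ = w ∧
      F.parent v₂ = w := by
  classical
  rcases hw with ⟨hwc, hd⟩ | ⟨hwc, hd⟩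
  · rw [hF] at hwc
    have hlw := F.root_lt w
    refine F.exists_children (A := {F.c (if F.root w + 1 = g then 0 else F.root w + 1),
      F.c (if F.root w = 0 then g - 1 else F.root w - 1)}) ?_ ?_
    · have := Finset.card_le_two (a := F.c (if F.root w + 1 = g then 0 else F.root w + 1))
        (b := F.c (if F.root w = 0 then g - 1 else F.root w - 1))
      omega
    · intro t ht
      rcases F.adj_cases ht with ⟨-, h2, h3⟩ | h | h
      · left
        have hlt := F.root_lt t
        rw [Finset.mem_insert, Finset.mem_singleton]
        have : F.root t = (if F.root w + 1 = g then 0 else F.root w + 1) ∨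
            F.root t = (if F.root w = 0 then g - 1 else F.root w - 1) := by
          simp only [cycDist] at h3
          split_ifs <;> omega
        rcases this with h | h
        · left; rw [← h, F.c_root t h2]
        · right; rw [← h, F.c_root t h2]
      · exact absurd hwc h.1
      · exact .inr h
  · rw [hF] at hwc
    refine F.exists_children (A := {F.parent w}) (by simpa using hd) ?_
    intro t ht
    rcases F.adj_cases ht with h | h | h
    · exact absurd h.1 hwc
    · left; simp [h.2]
    · exact .inr h

/-- A branching vertex has two children, and each singleton must meet one of their branches, so `x`
and `y` would share its root. -/
theorem branchActiveCount_eq_zero [Fintype V] [DecidableRel G.Adj]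
    (hF : ∀ v, v ∈ G.cycleVertices ↔ F.height v = 0) {x y : V} (hxy : F.root x ≠ F.root y)
    (hx : F.IsBranchResolving {x}) (hy : F.IsBranchResolving {y}) : G.branchActiveCount = 0 := by
  have hempty : {v | G.IsBranchActive v} = ∅ := by
    refine Set.eq_empty_iff_forall_notMem.2 ?_
    rintro v ⟨-, w, -, hw⟩
    obtain ⟨v₁, v₂, h1, h2, h3, h4, h5⟩ := F.exists_children_of_isBranching hF hw
    have key : ∀ z, F.IsBranchResolving {z} → F.root z = F.root w := by
      intro z hz
      obtain ⟨s, hs, hd⟩ := hz v₁ v₂ h1 h2 h3 (h4.trans h5.symm)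
      rw [Finset.mem_singleton] at hs
      subst hs
      rcases hd with hd | hd
      · rw [hd.root_eq, ← F.root_parent v₁ h2, h4]
      · rw [hd.root_eq, ← F.root_parent v₂ h3, h5]
    exact hxy ((key x hx).trans (key y hy).symm)
  rw [branchActiveCount, hempty, Set.ncard_empty]

end CycleFrame

theorem IsUnicyclic.of_two_isBasisForced [Fintype V] [DecidableRel G.Adj] (hG : G.IsUnicyclic)
    (hg : 4 ≤ G.girth) {x y : V} (hxy : x ≠ y) (hx : G.IsBasisForced x) (hy : G.IsBasisForced y) :
    G.branchActiveCount = 0 ∧ G.metricDim = 2 ∧ ∃! S : Finset V, G.IsMetricBasis S := by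
  classical
  obtain ⟨F, hF⟩ := hG.exists_cycleFrame
  obtain ⟨S, hS⟩ := exists_isMetricBasis hG.1
  obtain ⟨hSxy, hroot⟩ := F.eq_pair_of_isBasisForced hg hx hy hxy hS
  have ex : S.erase x = {y} := by
    rw [hSxy, Finset.erase_insert (by simpa using hxy)]
  have ey : S.erase y = {x} := by
    rw [hSxy, Finset.pair_comm, Finset.erase_insert (by simpa using hxy.symm)]
  have hBx := F.isBranchResolving_erase hx hS (y := y) (by simp [ex])
  have hBy := F.isBranchResolving_erase hy hS (y := x) (by simp [ey])
  rw [ex] at hBx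
  rw [ey] at hBy
  refine ⟨F.branchActiveCount_eq_zero hF hroot hBy hBx, ?_, S, hS, fun T hT => ?_⟩
  · rw [← hS.2, hSxy, Finset.card_pair hxy]
  · rw [hSxy]
    exact (F.eq_pair_of_isBasisForced hg hx hy hxy hT).1

theorem ncard_isBasisForced (h : G.metricDim = 2) (hu : ∃! S : Finset V, G.IsMetricBasis S) :
    {v | G.IsBasisForced v}.ncard = 2 := by
  obtain ⟨S, hS, hSu⟩ := hu
  have : {v | G.IsBasisForced v} = (S : Set V) := by
    ext v
    refine ⟨fun hv => hv S hS, fun hv T hT => ?_⟩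
    rw [hSu T hT]
    exact hv
  rw [this, Set.ncard_coe_finset, hS.2, h]

end SimpleGraph

theorem mainTheorem5 {V : Type*} [Fintype V] (G : SimpleGraph V) [DecidableRel G.Adj]
    (hG : G.IsUnicyclic) (hg : 4 ≤ G.girth) :
    ({v | G.IsBasisForced v}.ncard = 2 ↔
      G.branchActiveCount = 0 ∧ G.metricDim = 2 ∧ ∃! S : Finset V, G.IsMetricBasis S) ∧
    ((∃ u v : V, u ≠ v ∧ G.IsBasisForced u ∧ G.IsBasisForced v) ↔
      G.branchActiveCount = 0 ∧ G.metricDim = 2 ∧ ∃! S : Finset V, G.IsMetricBasis S) := by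
  have two : {v | G.IsBasisForced v}.ncard = 2 →
      ∃ u v : V, u ≠ v ∧ G.IsBasisForced u ∧ G.IsBasisForced v := by
    intro h
    obtain ⟨u, v, huv, he⟩ := Set.ncard_eq_two.1 h
    refine ⟨u, v, huv, ?_, ?_⟩
    · exact (Set.ext_iff.1 he u).2 (by simp)
    · exact (Set.ext_iff.1 he v).2 (by simp)
  refine ⟨⟨fun h => ?_, fun h => SimpleGraph.ncard_isBasisForced h.2.1 h.2.2⟩,
    ⟨?_, fun h => two (SimpleGraph.ncard_isBasisForced h.2.1 h.2.2)⟩⟩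
  · obtain ⟨u, v, huv, hu, hv⟩ := two h
    exact hG.of_two_isBasisForced hg huv hu hv
  · rintro ⟨u, v, huv, hu, hv⟩
    exact hG.of_two_isBasisForced hg huv hu hv
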